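/- All topological spaces are Hausdorff, and for a compact space $K$, $C(K)$ denotes the Banach space of all continuous real-valued functions on $K$ with the supremum norm. A compact space is scattered if each of its nonempty closed subsets $A$ contains a point that is isolated in $A$. A real Banach space $X$ is separably injective if for every separable real Banach space $Z$ and every closed linear subspace $Y\subseteq Z$, every bounded linear operator $T\colon Y\to X$ extends to a bounded linear operator $S\colon Z\to X$. If $K_1$ and $K_2$ are non-scattered compact spaces, then $C(K_1\times K_2)$ is not separably injective. In particular (a result of Clausen and Scholze), $C(\beta\omega\times\beta\omega)$ is not separably injective, where $\beta\omega$ is the Čech–Stone compactification of the discrete space $\omega$ of natural numbers. -/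

import Mathlib

open Topology

universe u v w

/-- A topological space is scattered if each nonempty closed subset `A` contains a point that is
isolated in `A`, i.e. a point `x` with `U ∩ A = {x}` for some open set `U`. -/
def IsScattered (K : Type u) [TopologicalSpace K] : Prop :=
  ∀ A : Set K, IsClosed A → A.Nonempty → ∃ x ∈ A, ∃ U : Set K, IsOpen U ∧ U ∩ A = {x}

/-- A real Banach space `X` is separably injective if for every separable Banach space `Z` and
each closed linear subspace `Y` of `Z`, every bounded operator `T : Y → X` extends to a bounded
operator `S : Z → X`. The universe `w` of the test spaces `Z` is a parameter. -/
def IsSeparablyInjective (X : Type v) [NormedAddCommGroup X] [NormedSpace ℝ X] : Prop :=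
  ∀ (Z : Type w) [NormedAddCommGroup Z] [NormedSpace ℝ Z] [CompleteSpace Z]
    [TopologicalSpace.SeparableSpace Z] (Y : Submodule ℝ Z), IsClosed (Y : Set Z) →
      ∀ T : Y →L[ℝ] X, ∃ S : Z →L[ℝ] X, ∀ y : Y, S (y : Z) = T y

/-! Both factors map onto `[0,1]`, hence functions on the square pull back to `C(K₁ × K₂)`. Suppose
that this operator extends to an operator `S`, bounded by `C`, on the separable closed span in `ℓ∞`
of the square of its continuous functions and countably many corner functions `c_q`, with centres
`q` in a dense set. Restrict the surjections to closed sets on which they are irreducible, and let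
`p` be their product. No continuous function is close to `c_q ∘ p` near the fibre of `q`, because
`c_q` is `0` along one line through `q` and `1` along the other. Irreducibility spreads the
resulting gap over the preimage of an open box, in which the next centre is chosen; so `n` centres
have gap at least `1/4` at a common point `w` (`exists_finset_forall_le_abs_sub_corner`).

Subtracting continuous functions `k_q` makes the `c_q` disjointly supported, so their signed sum `f`
has norm at most `1`. As `S` is prescribed on each `k_q`, suitable signs give `S f w ≥ n/4 - 1`,
which exceeds `C` for large `n`. -/

/-! ### Surjections onto the unit interval -/

theorem IsOpen.exists_disjoint_closure_of_forall_inter_ne_singleton {K : Type u}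
    [TopologicalSpace K] [T3Space K] {A : Set K}
    (hA : ∀ x ∈ A, ∀ U : Set K, IsOpen U → U ∩ A ≠ {x}) {U : Set K} (hU : IsOpen U)
    (hUA : (U ∩ A).Nonempty) :
    ∃ V : Bool → Set K, (∀ b, IsOpen (V b) ∧ (V b ∩ A).Nonempty ∧ closure (V b) ⊆ U) ∧
      Disjoint (closure (V false)) (closure (V true)) := by
  obtain ⟨x, hxU, hxA⟩ := hUA
  obtain ⟨y, ⟨hyU, hyA⟩, hyx⟩ : ∃ y ∈ U ∩ A, y ≠ x := by
    by_contra! h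
    exact hA x hxA U hU (Set.eq_singleton_iff_unique_mem.2 ⟨⟨hxU, hxA⟩, h⟩)
  obtain ⟨O₁, hx₁, ho₁, O₂, hy₂, ho₂, hd⟩ := exists_open_nhds_disjoint_closure hyx.symm
  have key : ∀ z O, z ∈ U → z ∈ A → z ∈ O → IsOpen O →
      ∃ V : Set K, IsOpen V ∧ (V ∩ A).Nonempty ∧ closure V ⊆ U ∧ closure V ⊆ closure O := by
    intro z O hzU hzA hzO hO
    obtain ⟨C, hC, hCc, hCU⟩ := exists_mem_nhds_isClosed_subset (hU.mem_nhds hzU)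
    refine ⟨interior C ∩ O, isOpen_interior.inter hO,
      ⟨z, ⟨mem_interior_iff_mem_nhds.2 hC, hzO⟩, hzA⟩, ?_, closure_mono Set.inter_subset_right⟩
    exact (closure_minimal (Set.inter_subset_left.trans interior_subset) hCc).trans hCU
  obtain ⟨V₁, h1, h2, h3, h4⟩ := key x O₁ hxU hxA hx₁ ho₁
  obtain ⟨V₂, k1, k2, k3, k4⟩ := key y O₂ hyU hyA hy₂ ho₂
  refine ⟨fun b => cond b V₂ V₁, ?_, hd.mono h4 k4⟩
  rintro (_ | _)
  exacts [⟨h1, h2, h3⟩, ⟨k1, k2, k3⟩]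

/-- A compact Hausdorff space carrying a Cantor scheme of open sets has a closed subset that maps
continuously onto the Cantor space. -/
theorem exists_isClosed_continuous_surjective_cantor {K : Type u} [TopologicalSpace K]
    [CompactSpace K] (D : List Bool → Set K) (hne : ∀ l, (D l).Nonempty)
    (hsub : ∀ b l, closure (D (b :: l)) ⊆ D l)
    (hdisj : ∀ l, Disjoint (closure (D (false :: l))) (closure (D (true :: l)))) :
    ∃ (B : Set K) (h : B → ℕ → Bool), IsClosed B ∧ Continuous h ∧ Function.Surjective h := by
  classical
  -- The head of a list is its newest digit, so `C b n` collects the closures with digit `b` in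
  -- position `n`.
  let C : Bool → ℕ → Set K := fun b n => ⋃ l ∈ {l : List Bool | l.length = n}, closure (D (b :: l))
  have hCc : ∀ b n, IsClosed (C b n) := fun b n =>
    (List.finite_length_eq Bool n).isClosed_biUnion fun _ _ => isClosed_closure
  have hdisj' : ∀ l l' : List Bool, l.length = l'.length → l ≠ l' →
      Disjoint (D l) (D l') := by
    intro l
    induction l with
    | nil => intro l' h1 h2; exact absurd (List.length_eq_zero_iff.1 h1.symm).symm h2
    | cons a l ih =>
      rintro (_ | ⟨a', l'⟩) h1 h2
      · simp at h1
      by_cases hl : l = l'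
      · subst hl
        have : a ≠ a' := fun h => h2 (by rw [h])
        rcases a <;> rcases a' <;> simp at this
        · exact (hdisj l).mono subset_closure subset_closure
        · exact (hdisj l).symm.mono subset_closure subset_closure
      · exact (ih l' (by simpa using h1) hl).mono (subset_closure.trans (hsub a l))
          (subset_closure.trans (hsub a' l'))
  have hCd : ∀ n, Disjoint (C false n) (C true n) := by
    intro n
    simp only [C, Set.disjoint_iUnion_left, Set.disjoint_iUnion_right, Set.mem_ofPred_eq]
    intro l' hl' l hl
    by_cases h : l = l'
    · subst h; exact hdisj l
    · exact (hdisj' l l' (hl.trans hl'.symm) h).mono (hsub _ _) (hsub _ _)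
  let B : Set K := ⋂ n, (C false n ∪ C true n)
  refine ⟨B, fun x n => decide (x.1 ∈ C true n),
    isClosed_iInter fun n => (hCc _ _).union (hCc _ _), ?_, ?_⟩
  · refine continuous_pi fun n => continuous_bool_rng true |>.2 ?_
    have e1 : (fun x : B => decide (x.1 ∈ C true n)) ⁻¹' {true} = Subtype.val ⁻¹' C true n := by
      ext x; simp
    have e2 : (Subtype.val ⁻¹' C true n : Set B) = (Subtype.val ⁻¹' C false n)ᶜ := by
      ext x
      have hx := Set.mem_iInter.1 x.2 n
      exact ⟨fun ht hf => Set.disjoint_left.1 (hCd n) hf ht, hx.resolve_left⟩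
    rw [e1]
    refine ⟨(hCc _ _).preimage continuous_subtype_val, ?_⟩
    rw [e2]
    exact ((hCc _ _).preimage continuous_subtype_val).isOpen_compl
  · intro b
    obtain ⟨x, hx⟩ := IsCompact.nonempty_iInter_of_sequence_nonempty_isCompact_isClosed
      (fun n => closure (D (PiNat.res b n)))
      (fun n => (hsub (b n) (PiNat.res b n)).trans subset_closure)
      (fun n => (hne _).closure) isClosed_closure.isCompact (fun n => isClosed_closure)
    have hxC : ∀ n, x ∈ C (b n) n := fun n =>
      Set.mem_biUnion (PiNat.res_length b n) (Set.mem_iInter.1 hx (n + 1))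
    refine ⟨⟨x, Set.mem_iInter.2 fun n => ?_⟩, funext fun n => ?_⟩
    · have := hxC n
      cases hb : b n <;> rw [hb] at this
      exacts [Or.inl this, Or.inr this]
    · have := hxC n
      cases hb : b n <;> rw [hb] at this
      · simpa using Set.disjoint_left.1 (hCd n) this
      · simpa using this

theorem exists_continuous_surjective_unitInterval_of_not_isScattered {K : Type u}
    [TopologicalSpace K] [CompactSpace K] [T2Space K] (hK : ¬ IsScattered K) :
    ∃ f : C(K, unitInterval), Function.Surjective f := by
  simp only [IsScattered, not_forall, not_exists, not_and] at hK
  obtain ⟨A, -, hAne, hA⟩ := hK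
  choose V hV hVd using fun U : {U : Set K // IsOpen U ∧ (U ∩ A).Nonempty} =>
    U.2.1.exists_disjoint_closure_of_forall_inter_ne_singleton hA U.2.2
  let D : List Bool → {U : Set K // IsOpen U ∧ (U ∩ A).Nonempty} := fun l =>
    l.rec ⟨Set.univ, isOpen_univ, by simpa using hAne⟩
      fun b _ U => ⟨V U b, (hV U b).1, (hV U b).2.1⟩
  obtain ⟨B, h, hB, hh, hhs⟩ := exists_isClosed_continuous_surjective_cantor
    (fun l => (D l).1) (fun l => (D l).2.2.mono Set.inter_subset_left)
    (fun b l => (hV (D l) b).2.2) (fun l => hVd (D l))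
  obtain ⟨g, hg, hgs⟩ := exists_nat_bool_continuous_surjective_of_compact unitInterval
  obtain ⟨f, hf⟩ := ContinuousMap.exists_extension' hB.isClosedEmbedding_subtypeVal
    (⟨g ∘ h, hg.comp hh⟩ : C(B, unitInterval))
  refine ⟨f, Function.Surjective.of_comp (g := ((↑) : B → K)) ?_⟩
  rw [hf]
  exact hgs.comp hhs

/-- Extend a dense sequence: the range is compact and dense. -/
theorem exists_continuous_surjective_stoneCech_nat_unitInterval :
    ∃ f : C(StoneCech ℕ, unitInterval), Function.Surjective f := by
  have hc : Continuous (TopologicalSpace.denseSeq unitInterval) := continuous_of_discreteTopology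
  refine ⟨⟨stoneCechExtend hc, continuous_stoneCechExtend hc⟩, ?_⟩
  have hcl : IsClosed (Set.range (stoneCechExtend hc)) :=
    (isCompact_range (continuous_stoneCechExtend hc)).isClosed
  rw [ContinuousMap.coe_mk, ← Set.range_eq_univ, ← hcl.closure_eq]
  refine ((TopologicalSpace.denseRange_denseSeq unitInterval).mono ?_).closure_eq
  rintro _ ⟨n, rfl⟩
  exact ⟨stoneCechUnit n, congrFun (stoneCechExtend_extends hc) n⟩

/-! ### Irreducible restrictions and extension of operators -/

/-- Every continuous surjection from a compact space restricts to an irreducible one. -/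
theorem exists_irreducible_restriction {K : Type u} {M : Type} [TopologicalSpace K]
    [CompactSpace K] [TopologicalSpace M] [T1Space M] {f : K → M} (hf : Continuous f)
    (hs : Function.Surjective f) :
    ∃ E : Set K, CompactSpace E ∧ (∀ m, ∃ x : E, f x = m) ∧
      ∀ E₀ : Set E, IsClosed E₀ → (∀ m, ∃ x ∈ E₀, f x = m) → E₀ = Set.univ := by
  -- The lift puts the target into the universe of `K`.
  obtain ⟨E, hE, hsE, hmin⟩ := exists_compact_surjective_zorn_subset
    (X := fun x => ULift.up.{u} (f x)) (continuous_uliftUp.comp hf)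
    (ULift.up_surjective.comp hs)
  refine ⟨E, hE, fun m => ?_, fun E₀ hc h => by_contra fun hne => hmin E₀ hne hc ?_⟩
  · obtain ⟨x, hx, h⟩ := Set.eq_univ_iff_forall.1 hsE ⟨m⟩
    exact ⟨⟨x, hx⟩, congrArg ULift.down h⟩
  · refine Set.eq_univ_of_forall fun m => ?_
    obtain ⟨x, hx, h⟩ := h m.down
    exact ⟨x, hx, ULift.down_injective h⟩

/-- A separably injective space admits extensions from `Y` to any subspace of a Banach space
spanned by `Y` and countably many further vectors. -/
theorem IsSeparablyInjective.exists_extension {X : Type v} [NormedAddCommGroup X]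
    [NormedSpace ℝ X] (hX : IsSeparablyInjective.{v, w} X) {Y E : Type} [NormedAddCommGroup Y]
    [NormedSpace ℝ Y] [CompleteSpace Y] [TopologicalSpace.SeparableSpace Y]
    [NormedAddCommGroup E] [NormedSpace ℝ E] [CompleteSpace E] (j : Y →ₗᵢ[ℝ] E) (T : Y →L[ℝ] X)
    {s : Set E} (hs : s.Countable) :
    ∃ (D : Submodule ℝ E) (S : E →ₗ[ℝ] X) (C : ℝ), 0 ≤ C ∧ (∀ y, j y ∈ D) ∧ s ⊆ D ∧
      (∀ z ∈ D, ‖S z‖ ≤ C * ‖z‖) ∧ ∀ y, S (j y) = T y := by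
  let D : Submodule ℝ E := (Submodule.span ℝ (Set.range j ∪ s)).topologicalClosure
  have hsub : Set.range j ∪ s ⊆ D :=
    Submodule.subset_span.trans (Submodule.le_topologicalClosure _)
  have hj : ∀ y, j y ∈ D := fun y => hsub (Or.inl ⟨y, rfl⟩)
  have hsep : TopologicalSpace.SeparableSpace D := by
    refine TopologicalSpace.IsSeparable.separableSpace (s := (D : Set E)) ?_
    rw [Submodule.topologicalClosure_coe]
    exact ((TopologicalSpace.isSeparable_range j.continuous).union hs.isSeparable).span.closure
  have hcomp : CompleteSpace D :=
    (Submodule.isClosed_topologicalClosure _).completeSpace_coe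
  let e : ULift.{w} D ≃ₗᵢ[ℝ] D := LinearIsometryEquiv.ulift ℝ D
  have hsep' : TopologicalSpace.SeparableSpace (ULift.{w} D) :=
    e.symm.surjective.denseRange.separableSpace e.symm.continuous
  let j₀ : Y →ₗᵢ[ℝ] D := ⟨j.toLinearMap.codRestrict D hj, fun y => j.norm_map y⟩
  let J : Y →ₗᵢ[ℝ] ULift.{w} D := e.symm.toLinearIsometry.comp j₀
  have hcl : IsClosed (LinearMap.range J.toLinearMap : Set (ULift.{w} D)) := by
    rw [LinearMap.coe_range]
    exact J.isometry.isClosedEmbedding.isClosed_range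
  obtain ⟨S, hS⟩ := hX (ULift.{w} D) (LinearMap.range J.toLinearMap) hcl
    (T.comp (J.equivRange.symm.toContinuousLinearEquiv : _ →L[ℝ] Y))
  let S₁ : D →L[ℝ] X := S.comp (e.symm.toContinuousLinearEquiv : D →L[ℝ] ULift.{w} D)
  -- A purely algebraic extension makes the map total; it stays bounded on `D` only.
  obtain ⟨S₂, hS₂⟩ := LinearMap.exists_extend (S₁ : D →ₗ[ℝ] X)
  have hS₂' : ∀ z : D, S₂ z = S₁ z := fun z => LinearMap.congr_fun hS₂ z
  refine ⟨D, S₂, ‖S₁‖, ContinuousLinearMap.opNorm_nonneg _, hj, Set.subset_union_right.trans hsub, ?_, ?_⟩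
  · intro z hz
    rw [hS₂' ⟨z, hz⟩]
    exact S₁.le_opNorm ⟨z, hz⟩
  · intro y
    rw [hS₂' ⟨j y, hj y⟩]
    have h : S (J y) = T y := by simpa using hS (J.equivRange y)
    exact h

/-- Continuous functions on a compact space, seen as bounded functions. -/
noncomputable def ContinuousMap.toLpInfty (P : Type*) [TopologicalSpace P] [CompactSpace P] :
    C(P, ℝ) →ₗᵢ[ℝ] lp (fun _ : P => ℝ) ⊤ where
  toFun f := ⟨fun z => f z, memℓp_infty ⟨‖f‖, by rintro _ ⟨z, rfl⟩; exact f.norm_coe_le_norm z⟩⟩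
  map_add' _ _ := rfl
  map_smul' _ _ := rfl
  norm_map' f := by
    let g : lp (fun _ : P => ℝ) ⊤ :=
      ⟨fun z => f z, memℓp_infty ⟨‖f‖, by rintro _ ⟨z, rfl⟩; exact f.norm_coe_le_norm z⟩⟩
    exact le_antisymm (lp.norm_le_of_forall_le (f := g) (norm_nonneg f) f.norm_coe_le_norm)
      ((f.norm_le (norm_nonneg g)).2 fun z => lp.norm_apply_le_norm ENNReal.top_ne_zero g z)

/-! ### Corner functions -/

section Corner

variable {M N : Type*} [MetricSpace M] [MetricSpace N]

/-- A function on a product that is continuous off `q` and has, arbitrarily near `q`, the value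
`0` on the horizontal and the value `1` on the vertical line through `q`. -/
noncomputable def corner (q z : M × N) : ℝ := dist z.2 q.2 / (dist z.1 q.1 + dist z.2 q.2)

theorem corner_nonneg (q z : M × N) : 0 ≤ corner q z := by unfold corner; positivity

theorem corner_le_one (q z : M × N) : corner q z ≤ 1 :=
  div_le_one_of_le₀ (le_add_of_nonneg_left dist_nonneg) (by positivity)

theorem continuousAt_corner {q z : M × N} (h : z ≠ q) : ContinuousAt (corner q) z := by
  refine ContinuousAt.div (by fun_prop) (by fun_prop) fun h0 => h ?_
  have h1 := dist_nonneg (x := z.1) (y := q.1)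
  have h2 := dist_nonneg (x := z.2) (y := q.2)
  exact Prod.ext (dist_eq_zero.1 (by linarith)) (dist_eq_zero.1 (by linarith))

theorem corner_horizontal (s a : M) (t : N) : corner (s, t) (a, t) = 0 := by simp [corner]

theorem corner_vertical (s : M) {t b : N} (h : b ≠ t) : corner (s, t) (s, b) = 1 := by
  simp [corner, dist_ne_zero.2 h]

/-- `corner q` as a bounded function. -/
noncomputable def cornerLp (q : M × N) : lp (fun _ : M × N => ℝ) ⊤ :=
  ⟨corner q, memℓp_infty ⟨1, by
    rintro _ ⟨z, rfl⟩
    exact (abs_of_nonneg (corner_nonneg q z)).trans_le (corner_le_one q z)⟩⟩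

/-- The factor vanishes at `q`, which removes the only discontinuity of the bounded function `corner
q`, and equals `1` at distance at least `δ` from `q`. -/
theorem exists_continuousMap_corner_mul (q : M × N) {δ : ℝ} (hδ : 0 < δ) :
    ∃ k : C(M × N, ℝ), ∀ z, k z = corner q z * min 1 (dist z q / δ) := by
  refine ⟨⟨fun z => corner q z * min 1 (dist z q / δ), ?_⟩, fun z => rfl⟩
  rw [continuous_iff_continuousAt]
  intro z
  by_cases h : z = q
  · subst h
    have h0 : corner z z * min 1 (dist z z / δ) = 0 := by simp
    rw [ContinuousAt, h0]
    refine squeeze_zero (g := fun y => dist y z / δ) (fun y => ?_) (fun y => ?_) ?_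
    · exact mul_nonneg (corner_nonneg _ _) (by positivity)
    · calc corner z y * min 1 (dist y z / δ) ≤ 1 * (dist y z / δ) :=
            mul_le_mul (corner_le_one _ _) (min_le_right _ _) (by positivity) zero_le_one
        _ = _ := one_mul _
    · have : Continuous fun y : M × N => dist y z / δ := by fun_prop
      simpa using this.tendsto z
  · exact (continuousAt_corner h).mul (by fun_prop)

end Corner

/-! ### Oscillation over fibres of irreducible surjections -/

/-- A fibre of a continuous surjection of a compact space onto a perfect space contains a limit
of points off the fibre. -/
theorem exists_mem_closure_preimage_compl {L M : Type*} [TopologicalSpace L] [CompactSpace L]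
    [TopologicalSpace M] [T2Space M] [PerfectSpace M] {p : L → M} (hp : Continuous p)
    (hs : Function.Surjective p) (m : M) : ∃ x ∈ closure (p ⁻¹' {m}ᶜ), p x = m := by
  have hcl : IsClosed (p '' closure (p ⁻¹' {m}ᶜ)) :=
    (isClosed_closure.isCompact.image hp).isClosed
  have hsub : ({m}ᶜ : Set M) ⊆ p '' closure (p ⁻¹' {m}ᶜ) := by
    rw [← Set.image_preimage_eq {m}ᶜ hs]
    exact Set.image_mono (by rw [Set.image_preimage_eq _ hs]; exact subset_closure)
  have : m ∈ p '' closure (p ⁻¹' {m}ᶜ) := by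
    rw [← hcl.closure_eq]
    exact closure_mono hsub (dense_compl_singleton m m)
  exact this

/-- A continuous surjection is irreducible if no proper closed subset is mapped onto. -/
structure IsIrreducibleSurjection {L M : Type*} [TopologicalSpace L] [TopologicalSpace M]
    (p : L → M) : Prop where
  continuous : Continuous p
  surjective : Function.Surjective p
  eq_univ : ∀ E : Set L, IsClosed E → (∀ m, ∃ x ∈ E, p x = m) → E = Set.univ

theorem IsIrreducibleSurjection.exists_isOpen_preimage_subset {L M : Type*} [TopologicalSpace L]
    [CompactSpace L] [TopologicalSpace M] [T2Space M] {p : L → M}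
    (hp : IsIrreducibleSurjection p) {O : Set L} (hO : IsOpen O) (hne : O.Nonempty) :
    ∃ G : Set M, IsOpen G ∧ G.Nonempty ∧ p ⁻¹' G ⊆ O := by
  refine ⟨(p '' Oᶜ)ᶜ, (hO.isClosed_compl.isCompact.image hp.continuous).isClosed.isOpen_compl,
    ?_, fun x hx => by_contra fun h => hx ⟨x, h, rfl⟩⟩
  by_contra h
  rw [Set.not_nonempty_iff_eq_empty, Set.compl_empty_iff, Set.eq_univ_iff_forall] at h
  obtain ⟨x, hx⟩ := hne
  exact (Set.eq_univ_iff_forall.1 (hp.eq_univ Oᶜ hO.isClosed_compl h) x) hx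

section Oscillation

variable {L₁ : Type u} {L₂ : Type v} {M N : Type*} [TopologicalSpace L₁] [TopologicalSpace L₂]
  [CompactSpace L₁] [CompactSpace L₂] [MetricSpace M] [MetricSpace N] [PerfectSpace M]
  [PerfectSpace N] {p₁ : L₁ → M} {p₂ : L₂ → N}

theorem exists_abs_sub_corner_gt (h₁ : IsIrreducibleSurjection p₁)
    (h₂ : IsIrreducibleSurjection p₂) (g : C(L₁ × L₂, ℝ)) {G : Set M} {H : Set N} (hG : IsOpen G)
    (hH : IsOpen H) {s : M} {t : N} (hs : s ∈ G) (ht : t ∈ H) :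
    ∃ w : L₁ × L₂, p₁ w.1 ∈ G ∧ p₂ w.2 ∈ H ∧ (p₁ w.1, p₂ w.2) ≠ (s, t) ∧
      1 / 4 < |g w - corner (s, t) (p₁ w.1, p₂ w.2)| := by
  obtain ⟨x, hx, rfl⟩ := exists_mem_closure_preimage_compl h₁.continuous h₁.surjective s
  obtain ⟨y, hy, rfl⟩ := exists_mem_closure_preimage_compl h₂.continuous h₂.surjective t
  have hU : IsOpen (p₁ ⁻¹' G ∩ {a | |g (a, y) - g (x, y)| < 1 / 8}) :=
    (hG.preimage h₁.continuous).inter (isOpen_lt (by fun_prop) (by fun_prop))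
  have hV : IsOpen (p₂ ⁻¹' H ∩ {b | |g (x, b) - g (x, y)| < 1 / 8}) :=
    (hH.preimage h₂.continuous).inter (isOpen_lt (by fun_prop) (by fun_prop))
  obtain ⟨a, ⟨haG, ha⟩, hax⟩ := mem_closure_iff.1 hx _ hU ⟨hs, by simp⟩
  obtain ⟨b, ⟨hbH, hb⟩, hby⟩ := mem_closure_iff.1 hy _ hV ⟨ht, by simp⟩
  have hax' : p₁ a ≠ p₁ x := hax
  have hby' : p₂ b ≠ p₂ y := hby
  replace ha : |g (a, y) - g (x, y)| < 1 / 8 := ha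
  replace hb : |g (x, b) - g (x, y)| < 1 / 8 := hb
  rw [abs_lt] at ha hb
  -- Moving off the fibre in one coordinate changes `g` by less than `1/8`, leaving a gap above `1/2
  -- - 1/8 > 1/4` from the corner value `0` or `1`.
  rcases le_total (1 / 2) (g (x, y)) with h | h
  · refine ⟨(a, y), haG, ht, fun h => hax' (Prod.ext_iff.1 h).1, ?_⟩
    rw [corner_horizontal, lt_abs]
    left; linarith
  · refine ⟨(x, b), hs, hbH, fun h => hby' (Prod.ext_iff.1 h).2, ?_⟩
    rw [corner_vertical _ hby', lt_abs]
    right; linarith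

/-- Off the fibre of `q` the strict gap persists near a point, and irreducibility fits preimages of
open sets into that neighbourhood. Keeping `q` out of the new box makes later centres distinct from
it. -/
theorem exists_isOpen_forall_le_abs_sub_corner (h₁ : IsIrreducibleSurjection p₁)
    (h₂ : IsIrreducibleSurjection p₂) (g : C(L₁ × L₂, ℝ)) {G : Set M} {H : Set N} (hG : IsOpen G)
    (hH : IsOpen H) {q : M × N} (hq : q ∈ G ×ˢ H) :
    ∃ (G' : Set M) (H' : Set N), IsOpen G' ∧ IsOpen H' ∧ G'.Nonempty ∧ H'.Nonempty ∧ G' ⊆ G ∧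
      H' ⊆ H ∧ q ∉ G' ×ˢ H' ∧ ∀ w : L₁ × L₂, p₁ w.1 ∈ G' → p₂ w.2 ∈ H' →
        1 / 4 ≤ |g w - corner q (p₁ w.1, p₂ w.2)| := by
  obtain ⟨w, hwG, hwH, hwq, hw⟩ := exists_abs_sub_corner_gt h₁ h₂ g hG hH hq.1 hq.2
  have hφ : Continuous fun w : L₁ × L₂ => (p₁ w.1, p₂ w.2) :=
    (h₁.continuous.comp continuous_fst).prodMk (h₂.continuous.comp continuous_snd)
  have hev : ∀ᶠ w' in 𝓝 w, (p₁ w'.1, p₂ w'.2) ∈ (G ×ˢ H) ∩ {q}ᶜ ∧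
      1 / 4 < |g w' - corner q (p₁ w'.1, p₂ w'.2)| := by
    refine (hφ.continuousAt.eventually_mem
      (((hG.prod hH).inter isOpen_compl_singleton).mem_nhds ⟨⟨hwG, hwH⟩, hwq⟩)).and ?_
    have hc : ContinuousAt (fun w' : L₁ × L₂ => |g w' - corner q (p₁ w'.1, p₂ w'.2)|) w :=
      (g.continuous.continuousAt.sub
        (ContinuousAt.comp (g := corner q) (continuousAt_corner hwq) hφ.continuousAt)).abs
    exact hc.eventually_const_lt hw
  obtain ⟨O₁, ho₁, O₂, ho₂, hO⟩ := mem_nhds_prod_iff.1 hev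
  obtain ⟨G', hG', hGne, hGO⟩ := h₁.exists_isOpen_preimage_subset isOpen_interior
    ⟨w.1, mem_interior_iff_mem_nhds.2 ho₁⟩
  obtain ⟨H', hH', hHne, hHO⟩ := h₂.exists_isOpen_preimage_subset isOpen_interior
    ⟨w.2, mem_interior_iff_mem_nhds.2 ho₂⟩
  have key : ∀ a b, p₁ a ∈ G' → p₂ b ∈ H' → (p₁ a, p₂ b) ∈ (G ×ˢ H) ∩ {q}ᶜ ∧
      1 / 4 < |g (a, b) - corner q (p₁ a, p₂ b)| := fun a b ha hb =>
    hO (Set.mk_mem_prod (interior_subset (hGO (a := a) ha)) (interior_subset (hHO (a := b) hb)))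
  have key' : ∀ z ∈ G' ×ˢ H', z ∈ (G ×ˢ H) ∩ {q}ᶜ := by
    rintro ⟨m, n⟩ ⟨hm, hn⟩
    obtain ⟨a, rfl⟩ := h₁.surjective m
    obtain ⟨b, rfl⟩ := h₂.surjective n
    exact (key a b hm hn).1
  refine ⟨G', H', hG', hH', hGne, hHne, fun m hm => ?_, fun n hn => ?_,
    fun h => (key' q h).2 rfl, fun w h1 h2 => (key w.1 w.2 h1 h2).2.le⟩
  · exact (key' (m, hHne.some) ⟨hm, hHne.some_mem⟩).1.1
  · exact (key' (hGne.some, n) ⟨hGne.some_mem, hn⟩).1.2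

/-- Continuous functions on `L₁ × L₂` cannot be uniformly close to many of the corner functions:
for any choice `g` of continuous functions, there are `n` corner functions with centres in a given
dense set which, at one point, all differ from the chosen functions by at least `1 / 4`. -/
theorem exists_finset_forall_le_abs_sub_corner [Nonempty M] [Nonempty N]
    (h₁ : IsIrreducibleSurjection p₁) (h₂ : IsIrreducibleSurjection p₂)
    (g : M × N → C(L₁ × L₂, ℝ)) {Q : Set (M × N)} (hQ : Dense Q) (n : ℕ) :
    ∃ (F : Finset (M × N)) (w : L₁ × L₂), F.card = n ∧ ↑F ⊆ Q ∧
      ∀ q ∈ F, 1 / 4 ≤ |g q w - corner q (p₁ w.1, p₂ w.2)| := by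
  classical
  suffices h : ∃ (F : Finset (M × N)) (G : Set M) (H : Set N), IsOpen G ∧ IsOpen H ∧
      G.Nonempty ∧ H.Nonempty ∧ F.card = n ∧ ↑F ⊆ Q ∧ ∀ q ∈ F, q ∉ G ×ˢ H ∧
        ∀ w : L₁ × L₂, p₁ w.1 ∈ G → p₂ w.2 ∈ H →
          1 / 4 ≤ |g q w - corner q (p₁ w.1, p₂ w.2)| by
    obtain ⟨F, G, H, -, -, ⟨a, ha⟩, ⟨b, hb⟩, hF, hFQ, h⟩ := h
    obtain ⟨x, rfl⟩ := h₁.surjective a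
    obtain ⟨y, rfl⟩ := h₂.surjective b
    exact ⟨F, (x, y), hF, hFQ, fun q hq => (h q hq).2 (x, y) ha hb⟩
  induction n with
  | zero => exact ⟨∅, Set.univ, Set.univ, isOpen_univ, isOpen_univ, Set.univ_nonempty,
      Set.univ_nonempty, rfl, by simp, by simp⟩
  | succ n ih =>
    obtain ⟨F, G, H, hG, hH, hGne, hHne, hF, hFQ, h⟩ := ih
    obtain ⟨q, hqGH, hqQ⟩ := hQ.inter_open_nonempty _ (hG.prod hH) (hGne.prod hHne)
    obtain ⟨G', H', hG', hH', hGne', hHne', hGG, hHH, hq, hw⟩ :=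
      exists_isOpen_forall_le_abs_sub_corner h₁ h₂ (g q) hG hH hqGH
    refine ⟨insert q F, G', H', hG', hH', hGne', hHne', ?_, ?_, ?_⟩
    · rw [Finset.card_insert_of_notMem fun hqF => (h q hqF).1 hqGH, hF]
    · rw [Finset.coe_insert]
      exact Set.insert_subset hqQ hFQ
    · intro q' hq'
      rcases Finset.mem_insert.1 hq' with rfl | hq'
      · exact ⟨hq, hw⟩
      · exact ⟨fun hm => (h q' hq').1 ⟨hGG hm.1, hHH hm.2⟩,
          fun w h1 h2 => (h q' hq').2 w (hGG h1) (hHH h2)⟩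

end Oscillation

/-! ### The norm estimate and the contradiction -/

/-- Corner functions with distinct centres can be modified by continuous functions so that their
combinations with coefficients of absolute value at most `1` are bounded by `1`. -/
theorem exists_forall_abs_sum_corner_sub_le_one {M N : Type*} [MetricSpace M] [MetricSpace N]
    (F : Finset (M × N)) :
    ∃ k : M × N → C(M × N, ℝ), ∀ ε : M × N → ℝ, (∀ q, |ε q| ≤ 1) →
      ∀ z, |∑ q ∈ F, ε q * (corner q z - k q z)| ≤ 1 := by
  -- The `δ`-balls about the centres are disjoint, so at most one summand is nonzero at each point.
  obtain ⟨δ, hδ, hFδ⟩ : ∃ δ > 0, ∀ q ∈ F, ∀ q' ∈ F, q ≠ q' → 2 * δ < dist q q' := by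
    have : ∀ᶠ δ in 𝓝[>] (0 : ℝ), ∀ q ∈ F, ∀ q' ∈ F, q ≠ q' → 2 * δ < dist q q' := by
      simp_rw [Filter.eventually_all_finset]
      intro q _ q' _
      by_cases h : q = q'
      · simp [h]
      · have hc : Filter.Tendsto (fun δ : ℝ => 2 * δ) (𝓝[>] 0) (𝓝 (2 * 0)) :=
          (Continuous.tendsto (by fun_prop) 0).mono_left nhdsWithin_le_nhds
        have hd : 2 * 0 < dist q q' := by rw [mul_zero]; exact dist_pos.2 h
        filter_upwards [hc.eventually_lt_const hd] with δ h1 _ using h1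
    obtain ⟨δ, h1, h2⟩ := (this.and self_mem_nhdsWithin).exists
    exact ⟨δ, h2, h1⟩
  choose k hk using fun q : M × N => exists_continuousMap_corner_mul q hδ
  have hfar : ∀ q z, δ ≤ dist z q → corner q z - k q z = 0 := by
    intro q z h
    rw [hk, min_eq_left ((one_le_div hδ).2 h), mul_one, sub_self]
  have hone : ∀ q z, |corner q z - k q z| ≤ 1 := by
    intro q z
    have h0 : 0 ≤ dist z q / δ := by positivity
    have hm : 0 ≤ min 1 (dist z q / δ) := le_min zero_le_one h0
    have hm' : min 1 (dist z q / δ) ≤ 1 := min_le_left _ _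
    rw [hk, ← mul_one_sub, abs_of_nonneg (mul_nonneg (corner_nonneg q z) (by linarith))]
    exact mul_le_one₀ (corner_le_one q z) (by linarith) (by linarith)
  refine ⟨k, fun ε hε z => ?_⟩
  by_cases h : ∃ q ∈ F, dist z q < δ
  · obtain ⟨q, hq, hz⟩ := h
    rw [Finset.sum_eq_single_of_mem q hq, abs_mul]
    · exact mul_le_one₀ (hε q) (abs_nonneg _) (hone q z)
    · intro q' hq' hne
      rw [hfar, mul_zero]
      by_contra! hlt
      have := hFδ q hq q' hq' hne.symm
      have := dist_triangle_left q q' z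
      linarith
  · push Not at h
    rw [Finset.sum_eq_zero fun q hq => by rw [hfar q z (h q hq), mul_zero], abs_zero]
    exact zero_le_one

theorem not_isSeparablyInjective_of_surjective {K₁ : Type u} {K₂ : Type v} [TopologicalSpace K₁]
    [CompactSpace K₁] [TopologicalSpace K₂] [CompactSpace K₂]
    (π₁ : C(K₁, unitInterval)) (π₂ : C(K₂, unitInterval)) (hπ₁ : Function.Surjective π₁)
    (hπ₂ : Function.Surjective π₂) :
    ¬ IsSeparablyInjective.{max u v, w} C(K₁ × K₂, ℝ) := by
  intro hX
  obtain ⟨E₁, hE₁, hs₁, hm₁⟩ := exists_irreducible_restriction π₁.continuous hπ₁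
  obtain ⟨E₂, hE₂, hs₂, hm₂⟩ := exists_irreducible_restriction π₂.continuous hπ₂
  have hp₁ : IsIrreducibleSurjection (fun x : E₁ => π₁ x) := ⟨by fun_prop, hs₁, hm₁⟩
  have hp₂ : IsIrreducibleSurjection (fun x : E₂ => π₂ x) := ⟨by fun_prop, hs₂, hm₂⟩
  obtain ⟨Q, hQc, hQ⟩ := TopologicalSpace.exists_countable_dense (unitInterval × unitInterval)
  let ι := ContinuousMap.toLpInfty (unitInterval × unitInterval)
  obtain ⟨D, S, C, hC, hjD, hsD, hSD, hS⟩ := hX.exists_extension ι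
    (ContinuousMap.compCLM ℝ ℝ (π₁.prodMap π₂)) (hQc.image cornerLp)
  let i : C(E₁ × E₂, K₁ × K₂) := ⟨fun w => (w.1, w.2), by fun_prop⟩
  -- Chosen so that `n/4 - 1 > C`.
  obtain ⟨n, hn⟩ := exists_nat_gt (4 * (C + 1))
  obtain ⟨F, w, hF, hFQ, hw⟩ := exists_finset_forall_le_abs_sub_corner hp₁ hp₂
    (fun q => (S (cornerLp q)).comp i) hQ n
  obtain ⟨k, hk⟩ := exists_forall_abs_sum_corner_sub_le_one F
  let r : unitInterval × unitInterval → ℝ := fun q =>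
    S (cornerLp q) (i w) - corner q (π₁ w.1, π₂ w.2)
  let ε : unitInterval × unitInterval → ℝ := fun q => SignType.sign (r q)
  have hε : ∀ q, |ε q| ≤ 1 := by
    intro q
    rcases lt_trichotomy (r q) 0 with h | h | h <;> simp [ε, h]
  let f : lp (fun _ : unitInterval × unitInterval => ℝ) ⊤ :=
    ∑ q ∈ F, ε q • (cornerLp q - ι (k q))
  have hf : ∀ z, f z = ∑ q ∈ F, ε q * (corner q z - k q z) := by
    intro z
    simp only [f, lp.coeFn_sum, Finset.sum_apply]
    exact Finset.sum_congr rfl fun q _ => rfl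
  have hf1 : ‖f‖ ≤ 1 := lp.norm_le_of_forall_le zero_le_one fun z => by
    rw [hf, Real.norm_eq_abs]
    exact hk ε hε z
  have hfD : f ∈ D := D.sum_mem fun q hq =>
    D.smul_mem _ (D.sub_mem (hsD ⟨q, hFQ hq, rfl⟩) (hjD _))
  have hSf : ‖S f‖ ≤ C := (hSD f hfD).trans (mul_le_of_le_one_right hC hf1)
  have hval : S f (i w) = ∑ q ∈ F, |r q| + f (π₁ w.1, π₂ w.2) := by
    rw [hf, ← Finset.sum_add_distrib]
    simp only [f, map_sum, map_smul, map_sub, hS, ContinuousMap.sum_apply]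
    refine Finset.sum_congr rfl fun q _ => ?_
    have e1 : |r q| = ε q * r q := (sign_mul_self (r q)).symm
    rw [e1, ← mul_add]
    change ε q * (S (cornerLp q) (i w) - k q (π₁ w.1, π₂ w.2)) = _
    congr 1
    simp only [r]
    ring
  have hsum : (n : ℝ) * (1 / 4) ≤ ∑ q ∈ F, |r q| := by
    rw [← hF, ← nsmul_eq_mul]
    exact Finset.card_nsmul_le_sum F _ _ hw
  have h1 : S f (i w) ≤ C := (le_abs_self _).trans (((S f).norm_coe_le_norm (i w)).trans hSf)
  have h2 : -1 ≤ f (π₁ w.1, π₂ w.2) := by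
    rw [hf]
    exact (abs_le.1 (hk ε hε _)).1
  linarith

theorem corollary1p5 :
    (∀ (K₁ : Type u) (K₂ : Type v) [TopologicalSpace K₁] [CompactSpace K₁] [T2Space K₁]
        [TopologicalSpace K₂] [CompactSpace K₂] [T2Space K₂],
        ¬ IsScattered K₁ → ¬ IsScattered K₂ →
          ¬ IsSeparablyInjective.{max u v, w} C(K₁ × K₂, ℝ)) ∧
      ¬ IsSeparablyInjective.{0, w} C(StoneCech ℕ × StoneCech ℕ, ℝ) := by
  constructor
  · intro K₁ K₂ _ _ _ _ _ _ h₁ h₂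
    obtain ⟨π₁, hπ₁⟩ := exists_continuous_surjective_unitInterval_of_not_isScattered h₁
    obtain ⟨π₂, hπ₂⟩ := exists_continuous_surjective_unitInterval_of_not_isScattered h₂
    exact not_isSeparablyInjective_of_surjective π₁ π₂ hπ₁ hπ₂
  · obtain ⟨π, hπ⟩ := exists_continuous_surjective_stoneCech_nat_unitInterval
    exact not_isSeparablyInjective_of_surjective π π hπ hπ
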